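/- Let $(S,A,P,r,\gamma)$ be a discounted Markov decision process: $S$ is a measurable space (for instance a Borel subset of $\mathbb R^m$), $A$ is a countable discrete action space, $P$ is a probability kernel from $S\times A$ to $S$, $r:S\times A\to\mathbb R$ is bounded and measurable, and $\gamma\in(0,1)$. A policy is a probability kernel from $S$ to $A$; fix a reference policy $\pi^{\rm ref}$. For a policy $\pi$, let $\zeta^\pi_{x,a}$ be the law of $\sum_{t\ge 0}\gamma^t r(X_t,A_t)$, where $(X_0,A_0)=(x,a)$, $X_{t+1}\sim P_{X_t,A_t}$ and $A_{t+1}\sim\pi_{X_{t+1}}$. Let $q^\pi(x,a)$ be the mean of $\zeta^\pi_{x,a}$ and let $q^\star=\sup_\pi q^\pi$. For $\tau>0$ and bounded measurable $q:S\times A\to\mathbb R$ put $$(V_\tau q)(x)=\tau\log\int e^{q(x,a)/\tau}\,d\pi^{\rm ref}_x(a),\qquad d(B_\tau q)_x(a)=e^{(q(x,a)-(V_\tau q)(x))/\tau}\,d\pi^{\rm ref}_x(a).$$ Let $q^\star_\tau$ be the unique bounded measurable solution of $q(x,a)=r(x,a)+\gamma\int V_\tau q\,dP_{x,a}$, and let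 $\bar q^\star$ be the unique bounded measurable solution of $q(x,a)=r(x,a)+\gamma\int \operatorname{ess\,sup}_{\pi^{\rm ref}_{x'}}q(x',\cdot)\,dP_{x,a}(x')$. For $q:S\times A\to\mathbb R$ write $O_q(x)=\{a\in A: q(x,a)=\operatorname{ess\,sup}_{\pi^{\rm ref}_x}q(x,\cdot)\}$. Let $\bar\pi^\star_x$ be $\pi^{\rm ref}_x$ restricted to $O_{\bar q^\star}(x)$ and normalized to a probability measure. Assume that there is $p_{\min}>0$ with $\pi^{\rm ref}_x(O_{q^\star_\tau}(x))\ge p_{\min}$ for all $\tau>0$ and all $x\in S$. Let $\sigma=\sigma(\tau)>0$ be such that $\sigma(\tau)/\tau\to0$ as $\tau\downarrow0$, and let $\zeta^{\tau,\sigma}$ be the return distribution function of the decoupled policy $\pi^{\tau,\sigma}=B_\tau q^\star_{\sigma}$. Then, for all $p,p'\in[1,\infty)$ and every probability measure $\omega$ on $S\times A$, $$\left(\int w_p\big(\zeta^{\tau,\sigma(\tau)}_{x,a},\zeta^{\bar\pi^\star}_{x,a}\big)^{p'}\,d\omega(x,a)\right)^{1/p'}\longrightarrow 0\qquad\text{as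 }\tau\downarrow0,$$ where $w_p$ is the $p$-Wasserstein distance on $\mathbb R$. Moreover, if $q^\star=\bar q^\star$, the same convergence holds with $\bar\pi^\star$ replaced by the policy obtained by restricting $\pi^{\rm ref}_x$ to $O_{q^\star}(x)$ and normalizing. -/

import Mathlib

open MeasureTheory ProbabilityTheory Filter Topology
open scoped ENNReal

noncomputable section

/-- A discounted Markov decision process with state space `S` and action space `A`: a transition
probability kernel `P`, a bounded measurable reward `r`, and a discount factor `γ ∈ (0, 1)`. -/
structure MDP (S A : Type*) [MeasurableSpace S] [MeasurableSpace A] where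
  P : Kernel (S × A) S
  isMarkov : IsMarkovKernel P
  r : S × A → ℝ
  measurable_r : Measurable r
  bounded_r : ∃ C : ℝ, ∀ z, |r z| ≤ C
  γ : ℝ
  γ_pos : 0 < γ
  γ_lt_one : γ < 1

namespace MDP

variable {S A : Type*} [MeasurableSpace S] [MeasurableSpace A]

instance (M : MDP S A) : IsMarkovKernel M.P := M.isMarkov

/-! ### Trajectories and return distributions -/

/-- The state-action transition kernel of a policy `π`: from `(x, a)`, draw `x'` from `P (x, a)`
and then `a'` from `π x'`. -/
def stepKernel (M : MDP S A) (π : Kernel S A) : Kernel (S × A) (S × A) :=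
  M.P ⊗ₖ (π.prodMkLeft (S × A))

instance (M : MDP S A) (π : Kernel S A) [IsMarkovKernel π] : IsMarkovKernel (M.stepKernel π) := by
  unfold stepKernel; infer_instance

/-- The transition kernel of `π` seen as a kernel from the history up to time `n`. -/
def historyKernel (M : MDP S A) (π : Kernel S A) (n : ℕ) :
    Kernel ((i : Finset.Iic n) → S × A) (S × A) :=
  (M.stepKernel π).comap (fun h => h ⟨n, Finset.mem_Iic.2 le_rfl⟩) (measurable_pi_apply _)

instance (M : MDP S A) (π : Kernel S A) [IsMarkovKernel π] (n : ℕ) :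
    IsMarkovKernel (M.historyKernel π n) := by
  unfold historyKernel; infer_instance

/-- The law of the whole state-action sequence `(X_t, A_t)_{t ≥ 0}` under `π`, given
`(X_0, A_0) = (x, a)`. -/
def trajKernel (M : MDP S A) (π : Kernel S A) [IsMarkovKernel π] :
    Kernel (S × A) (ℕ → S × A) :=
  (Kernel.traj (X := fun _ => S × A) (M.historyKernel π) 0).comap (fun z _ => z)
    (measurable_pi_lambda _ fun _ => measurable_id)

/-- The discounted return of a trajectory. -/
def discountedReturn (M : MDP S A) (ω : ℕ → S × A) : ℝ :=
  ∑' t : ℕ, M.γ ^ t * M.r (ω t)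

/-- The return distribution function `ζ^π`. -/
def returnDist (M : MDP S A) (π : Kernel S A) [IsMarkovKernel π] : Kernel (S × A) ℝ :=
  (M.trajKernel π).map M.discountedReturn

/-- The action-value function `q^π`, the mean of `ζ^π`. -/
def qValue (M : MDP S A) (π : Kernel S A) [IsMarkovKernel π] (z : S × A) : ℝ :=
  ∫ g, g ∂(M.returnDist π z)

/-- The (classical) optimal action-value function `q^⋆`, the supremum of `q^π` over all
policies. -/
def qStar (M : MDP S A) (z : S × A) : ℝ :=
  ⨆ π : {π : Kernel S A // IsMarkovKernel π}, haveI := π.2; M.qValue π.1 z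

/-! ### Bellman operators -/

/-- `(V_τ q)(x) = τ log ∫ exp (q (x, a) / τ) dπref_x(a)`. -/
def vLSE (πref : Kernel S A) (τ : ℝ) (q : S × A → ℝ) (x : S) : ℝ :=
  τ * Real.log (∫ a, Real.exp (q (x, a) / τ) ∂(πref x))

/-- The soft Bellman optimality operator at temperature `τ`. -/
def softBellman (M : MDP S A) (πref : Kernel S A) (τ : ℝ) (q : S × A → ℝ) (z : S × A) : ℝ :=
  M.r z + M.γ * ∫ x', vLSE πref τ q x' ∂(M.P z)

/-- The Bellman reference-optimality operator. -/
def refBellman (M : MDP S A) (πref : Kernel S A) (q : S × A → ℝ) (z : S × A) : ℝ :=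
  M.r z + M.γ * ∫ x', essSup (fun a => q (x', a)) (πref x') ∂(M.P z)

/-- `q` is a fixed point of `T` in the space of bounded measurable functions. -/
def IsBddFixedPoint (T : (S × A → ℝ) → S × A → ℝ) (q : S × A → ℝ) : Prop :=
  Measurable q ∧ (∃ C : ℝ, ∀ z, |q z| ≤ C) ∧ T q = q

/-- `q^⋆_τ`, the (unique) bounded measurable fixed point of the soft Bellman optimality
operator. -/
def qSoft (M : MDP S A) (πref : Kernel S A) (τ : ℝ) : S × A → ℝ :=
  Classical.epsilon (IsBddFixedPoint (M.softBellman πref τ))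

/-- The reference-optimal action-value function, the (unique) bounded measurable fixed point of
the Bellman reference-optimality operator. -/
def qRef (M : MDP S A) (πref : Kernel S A) : S × A → ℝ :=
  Classical.epsilon (IsBddFixedPoint (M.refBellman πref))

/-! ### Policies -/

/-- Makes a kernel `κ` a total policy: equal to `κ x` wherever `κ x` is a probability measure.
The value `πref x` elsewhere is a convention. -/
def toPolicy (πref κ : Kernel S A) : Kernel S A :=
  open Classical in
  Kernel.piecewise (s := (fun x => κ x Set.univ) ⁻¹' {1})
    (κ.measurable_coe MeasurableSet.univ (measurableSet_singleton 1)) κ πref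

instance (πref κ : Kernel S A) [IsMarkovKernel πref] : IsMarkovKernel (toPolicy πref κ) := by
  refine ⟨fun x => ⟨?_⟩⟩
  classical
  unfold toPolicy
  rw [Kernel.piecewise_apply']
  split_ifs with h
  · exact h
  · exact measure_univ

/-- The Boltzmann–Gibbs policy with potential `q` and temperature `τ`, which has density
`exp ((q (x, a) - (V_τ q)(x)) / τ)` with respect to `πref x`. -/
def boltzmann (πref : Kernel S A) [IsMarkovKernel πref] (τ : ℝ) (q : S × A → ℝ) : Kernel S A :=
  toPolicy πref
    (πref.withDensity fun x a => ENNReal.ofReal (Real.exp ((q (x, a) - vLSE πref τ q x) / τ)))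

instance (πref : Kernel S A) [IsMarkovKernel πref] (τ : ℝ) (q : S × A → ℝ) :
    IsMarkovKernel (boltzmann πref τ q) := by
  unfold boltzmann; infer_instance

/-- The set of actions at which `q (x, ·)` equals its essential supremum under `πref x`. -/
def optActions (πref : Kernel S A) (q : S × A → ℝ) (x : S) : Set A :=
  {a | q (x, a) = essSup (fun a' => q (x, a')) (πref x)}

/-- The reference policy filtered by `q`: `πref x` restricted to `optActions πref q x` and
normalized. -/
def filteredPolicy (πref : Kernel S A) [IsMarkovKernel πref] (q : S × A → ℝ) : Kernel S A :=
  toPolicy πref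
    (πref.withDensity fun x a =>
      (πref x (optActions πref q x))⁻¹ * (optActions πref q x).indicator (fun _ => 1) a)

instance (πref : Kernel S A) [IsMarkovKernel πref] (q : S × A → ℝ) :
    IsMarkovKernel (filteredPolicy πref q) := by
  unfold filteredPolicy; infer_instance

/-- The coverage assumption on the reference policy. -/
def Coverage (M : MDP S A) (πref : Kernel S A) : Prop :=
  ∃ pmin : ℝ≥0∞, 0 < pmin ∧
    ∀ τ : ℝ, 0 < τ → ∀ x : S, pmin ≤ πref x (optActions πref (M.qSoft πref τ) x)

/-- The temperature-decoupled policy `π^{τ,σ}`: the Boltzmann–Gibbs policy at temperature `τ`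
whose potential is `q^⋆_σ`. -/
def decoupledPolicy (M : MDP S A) (πref : Kernel S A) [IsMarkovKernel πref] (τ σ : ℝ) :
    Kernel S A :=
  boltzmann πref τ (M.qSoft πref σ)

instance (M : MDP S A) (πref : Kernel S A) [IsMarkovKernel πref] (τ σ : ℝ) :
    IsMarkovKernel (M.decoupledPolicy πref τ σ) := by
  unfold decoupledPolicy; infer_instance

end MDP

/-- The `p`-Wasserstein distance of measures on `ℝ`, as an infimum over couplings. -/
def wasserstein (p : ℝ) (μ ν : Measure ℝ) : ℝ≥0∞ :=
  (⨅ κ ∈ {κ : Measure (ℝ × ℝ) | κ.map Prod.fst = μ ∧ κ.map Prod.snd = ν},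
    ∫⁻ z, edist z.1 z.2 ^ p ∂κ) ^ (1 / p)

/-- The integrated Wasserstein metric `w̄_{p,p';ω}(ζ, ζ') = (∫ w_p(ζ_y, ζ'_y)^{p'} dω(y))^{1/p'}`. -/
def integratedWasserstein {Y : Type*} [MeasurableSpace Y] (p p' : ℝ) (ω : Measure Y)
    (ζ ζ' : Kernel Y ℝ) : ℝ≥0∞ :=
  (∫⁻ y, wasserstein p (ζ y) (ζ' y) ^ p' ∂ω) ^ (1 / p')

end

/-!
If `m` is the essential supremum of `q^⋆_τ` over actions, coverage gives
`m + τ log p_min ≤ V_τ q^⋆_τ ≤ m`, so the soft and the reference Bellman fixed points differ by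
`O(τ)`. Hence `(q^⋆_σ - q̄^⋆) / τ = O(σ / τ) → 0`, and in the decoupled policy the potential,
normalized by its maximum, tends to `0` on the optimal actions and to `-∞` elsewhere: by dominated
convergence the policy converges in total variation, at every state, to `πref` conditioned on the
optimal actions.

Total variation convergence of policies passes to the laws of finite trajectories one transition at
a time. The discounted return is a uniform limit of functions of finitely many steps, so its law
converges weakly. All returns are bounded by a common constant, and on the line weak convergence
together with such a bound gives Wasserstein convergence through the quantile coupling; dominated
convergence then handles the integral against `ω`.
-/

/-! ### Convergence in total variation -/

/-- Convergence of `μs` to `μ` in total variation along `l`. The test function may vary with the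
index, which makes the convergence uniform over all measurable functions with values in
`[-1, 1]`. -/
def TVTendsto {ι X : Type*} [MeasurableSpace X] (l : Filter ι) (μs : ι → Measure X)
    (μ : Measure X) : Prop :=
  ∀ f : ι → X → ℝ, (∀ i, Measurable (f i)) → (∀ i x, |f i x| ≤ 1) →
    Tendsto (fun i => ∫ x, f i x ∂μs i - ∫ x, f i x ∂μ) l (𝓝 0)

theorem integrable_of_measurable_of_abs_le {X : Type*} [MeasurableSpace X] {μ : Measure X}
    [IsFiniteMeasure μ] {f : X → ℝ} {C : ℝ} (hf : Measurable f) (hC : ∀ x, |f x| ≤ C) :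
    Integrable f μ :=
  .of_bound hf.aestronglyMeasurable C (ae_of_all _ hC)

theorem abs_integral_le_of_abs_le {X : Type*} [MeasurableSpace X] {μ : Measure X}
    [IsProbabilityMeasure μ] {f : X → ℝ} {C : ℝ} (hC : ∀ x, |f x| ≤ C) :
    |∫ x, f x ∂μ| ≤ C := by
  simpa using norm_integral_le_of_norm_le_const (μ := μ) (f := f) (ae_of_all _ hC)

namespace TVTendsto

variable {ι X Y : Type*} [MeasurableSpace X] [MeasurableSpace Y] {l : Filter ι}

theorem const (μ : Measure X) : TVTendsto l (fun _ => μ) μ := fun f _ _ => by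
  simpa only [sub_self] using tendsto_const_nhds

theorem congr' {μs νs : ι → Measure X} {μ : Measure X} (h : TVTendsto l μs μ)
    (hν : ∀ᶠ i in l, μs i = νs i) : TVTendsto l νs μ := fun f hf hf1 =>
  (h f hf hf1).congr' (hν.mono fun i hi => by rw [hi])

theorem map {μs : ι → Measure X} {μ : Measure X} (h : TVTendsto l μs μ) {g : X → Y}
    (hg : Measurable g) : TVTendsto l (fun i => (μs i).map g) (μ.map g) := by
  intro f hf hf1
  simp_rw [fun (i : ι) (ν : Measure X) =>
    integral_map (μ := ν) hg.aemeasurable (hf i).aestronglyMeasurable]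
  exact h (fun i x => f i (g x)) (fun i => (hf i).comp hg) fun i x => hf1 i _

theorem tendsto_integral {μs : ι → Measure X} {μ : Measure X} (h : TVTendsto l μs μ)
    {f : X → ℝ} (hf : Measurable f) {C : ℝ} (hC : ∀ x, |f x| ≤ C) :
    Tendsto (fun i => ∫ x, f x ∂μs i) l (𝓝 (∫ x, f x ∂μ)) := by
  obtain ⟨D, hCD, hD⟩ : ∃ D, C ≤ D ∧ 0 < D := ⟨max C 1, le_max_left _ _, by positivity⟩
  have hscaled := h (fun _ x => f x / D) (fun _ => hf.div_const D) fun _ x => by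
    rw [abs_div, abs_of_pos hD]
    exact div_le_one_of_le₀ ((hC x).trans hCD) hD.le
  simp only [integral_div, ← sub_div] at hscaled
  simpa [div_mul_cancel₀ _ hD.ne'] using (hscaled.mul_const D).add_const (∫ x, f x ∂μ)

theorem compProd [l.IsCountablyGenerated] {μs : ι → Measure X} {μ : Measure X}
    [∀ i, IsProbabilityMeasure (μs i)] [IsProbabilityMeasure μ]
    {κs : ι → Kernel X Y} {κ : Kernel X Y} [∀ i, IsMarkovKernel (κs i)] [IsMarkovKernel κ]
    (hμ : TVTendsto l μs μ) (hκ : ∀ x, TVTendsto l (fun i => κs i x) (κ x)) :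
    TVTendsto l (fun i => μs i ⊗ₘ κs i) (μ ⊗ₘ κ) := by
  intro f hf hf1
  have hmeas (i : ι) (η : Kernel X Y) [IsMarkovKernel η] :
      Measurable fun x => ∫ y, f i (x, y) ∂η x :=
    (hf i).stronglyMeasurable.integral_kernel_prod_right'.measurable
  have hbound (i : ι) (η : Kernel X Y) [IsMarkovKernel η] (x : X) :
      |∫ y, f i (x, y) ∂η x| ≤ 1 := abs_integral_le_of_abs_le fun y => hf1 i _
  have hmeasure := hμ (fun i x => ∫ y, f i (x, y) ∂κs i x) (fun i => hmeas i _)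
    fun i x => hbound i _ x
  have hkernel : Tendsto (fun i => ∫ x, (∫ y, f i (x, y) ∂κs i x - ∫ y, f i (x, y) ∂κ x) ∂μ) l
      (𝓝 (∫ _, (0 : ℝ) ∂μ)) := by
    refine tendsto_integral_filter_of_dominated_convergence (fun _ => 1 + 1)
      (.of_forall fun i => ((hmeas i _).sub (hmeas i _)).aestronglyMeasurable)
      (.of_forall fun i => ae_of_all _ fun x =>
        (abs_sub _ _).trans (add_le_add (hbound i _ x) (hbound i _ x))) (integrable_const _)
      (ae_of_all _ fun x => hκ x (fun i y => f i (x, y))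
        (fun i => (hf i).comp measurable_prodMk_left) fun i y => hf1 i _)
  have hsum := hmeasure.add hkernel
  simp only [integral_zero, add_zero] at hsum
  refine hsum.congr fun i => ?_
  rw [Measure.integral_compProd (integrable_of_measurable_of_abs_le (hf i) (hf1 i)),
    Measure.integral_compProd (integrable_of_measurable_of_abs_le (hf i) (hf1 i)),
    integral_sub (integrable_of_measurable_of_abs_le (hmeas i _) (hbound i _))
      (integrable_of_measurable_of_abs_le (hmeas i _) (hbound i _))]
  ring

theorem partialTraj [l.IsCountablyGenerated] {X : ℕ → Type*} [∀ n, MeasurableSpace (X n)]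
    {κs : ι → (n : ℕ) → Kernel ((i : Finset.Iic n) → X i) (X (n + 1))}
    {κ : (n : ℕ) → Kernel ((i : Finset.Iic n) → X i) (X (n + 1))}
    [∀ i n, IsMarkovKernel (κs i n)] [∀ n, IsMarkovKernel (κ n)]
    (h : ∀ n x, TVTendsto l (fun i => κs i n x) (κ n x)) {a b : ℕ} (hab : a ≤ b)
    (x : (i : Finset.Iic a) → X i) :
    TVTendsto l (fun i => Kernel.partialTraj (κs i) a b x) (Kernel.partialTraj κ a b x) := by
  induction b, hab using Nat.le_induction with
  | base => simpa only [Kernel.partialTraj_self] using const _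
  | succ b hab ih =>
    have hsucc (η : (n : ℕ) → Kernel ((i : Finset.Iic n) → X i) (X (n + 1)))
        [∀ n, IsMarkovKernel (η n)] : Kernel.partialTraj η a (b + 1) x =
          (Kernel.partialTraj η a b x ⊗ₘ (η b).map (MeasurableEquiv.piSingleton b)).map
            (IicProdIoc b (b + 1)) := by
      rw [Kernel.partialTraj_succ_of_le hab, Kernel.map_apply _ measurable_IicProdIoc,
        Kernel.comp_apply, Measure.compProd_eq_comp_prod]
    have hmarkov (η : (n : ℕ) → Kernel ((i : Finset.Iic n) → X i) (X (n + 1)))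
        [∀ n, IsMarkovKernel (η n)] :
        IsMarkovKernel ((η b).map (MeasurableEquiv.piSingleton (X := X) b)) :=
      Kernel.IsMarkovKernel.map _ (MeasurableEquiv.measurable _)
    simp only [hsucc]
    refine (ih.compProd fun w => ?_).map measurable_IicProdIoc
    simp only [Kernel.map_apply _ (MeasurableEquiv.measurable _)]
    exact (h b w).map (MeasurableEquiv.measurable _)

end TVTendsto

section Laplace

variable {ι X : Type*} [MeasurableSpace X] {l : Filter ι} [l.IsCountablyGenerated]
  {μ : Measure X} [IsFiniteMeasure μ] {fs : ι → X → ℝ} {s : Set X} {K : ℝ}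

theorem tendsto_integral_exp_mul_sub_setIntegral (hs : MeasurableSet s)
    (hfs : ∀ᶠ i in l, Measurable (fs i)) (hK : ∀ᶠ i in l, ∀ᵐ x ∂μ, fs i x ≤ K)
    (hmem : ∀ᵐ x ∂μ, x ∈ s → Tendsto (fs · x) l (𝓝 0))
    (hnot : ∀ᵐ x ∂μ, x ∉ s → Tendsto (fs · x) l atBot)
    {gs : ι → X → ℝ} (hgs : ∀ i, Measurable (gs i)) (hgs1 : ∀ i x, |gs i x| ≤ 1) :
    Tendsto (fun i => ∫ x, Real.exp (fs i x) * gs i x ∂μ - ∫ x in s, gs i x ∂μ) l (𝓝 0) := by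
  have hlim : ∀ᵐ x ∂μ, Tendsto (fun i => Real.exp (fs i x) - s.indicator 1 x) l (𝓝 0) := by
    filter_upwards [hmem, hnot] with x hx_mem hx_not
    by_cases hxs : x ∈ s
    · simpa [hxs] using ((Real.continuous_exp.tendsto _).comp (hx_mem hxs)).sub_const 1
    · simpa only [hxs, not_false_eq_true, Set.indicator_of_notMem, sub_zero,
        Function.comp_def] using Real.tendsto_exp_atBot.comp (hx_not hxs)
  have hind : Measurable (s.indicator (1 : X → ℝ)) := measurable_one.indicator hs
  have hdom : Tendsto (fun i => ∫ x, (Real.exp (fs i x) - s.indicator 1 x) * gs i x ∂μ) l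
      (𝓝 (∫ _, (0 : ℝ) ∂μ)) := by
    refine tendsto_integral_filter_of_dominated_convergence (fun _ => (Real.exp K + 1) * 1) ?_ ?_
      (integrable_const _) ?_
    · filter_upwards [hfs] with i hi
      exact ((hi.exp.sub hind).mul (hgs i)).aestronglyMeasurable
    · filter_upwards [hK] with i hi
      filter_upwards [hi] with x hx
      rw [norm_mul]
      gcongr
      · refine (norm_sub_le _ _).trans (add_le_add ?_ ?_)
        · simpa using hx
        · by_cases hxs : x ∈ s <;> simp [hxs]
      · exact hgs1 i x
    · filter_upwards [hlim] with x hx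
      exact hx.zero_mul_isBoundedUnder_le (isBoundedUnder_of ⟨1, fun i => hgs1 i x⟩)
  simp only [integral_zero] at hdom
  refine hdom.congr' ?_
  filter_upwards [hfs, hK] with i hi hKi
  have hexp : Integrable (fun x => Real.exp (fs i x) * gs i x) μ := by
    refine (Integrable.of_bound hi.exp.aestronglyMeasurable (Real.exp K) ?_).mul_bdd
      (hgs i).aestronglyMeasurable (ae_of_all _ (hgs1 i))
    filter_upwards [hKi] with x hx
    simpa using hx
  rw [← integral_indicator hs, ← integral_sub hexp
    ((integrable_of_measurable_of_abs_le (hgs i) (hgs1 i)).indicator hs)]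
  refine integral_congr_ae (ae_of_all _ fun x => ?_)
  by_cases hxs : x ∈ s <;> simp [hxs, sub_mul]

/-- Laplace's principle: the numerator and the partition function of the tilted measure are
compared separately with the integral over `s` and with `μ s`. -/
theorem tvTendsto_tilted_cond (hs : MeasurableSet s) (hμs : μ s ≠ 0)
    (hfs : ∀ᶠ i in l, Measurable (fs i)) (hK : ∀ᶠ i in l, ∀ᵐ x ∂μ, fs i x ≤ K)
    (hmem : ∀ᵐ x ∂μ, x ∈ s → Tendsto (fs · x) l (𝓝 0))
    (hnot : ∀ᵐ x ∂μ, x ∉ s → Tendsto (fs · x) l atBot) :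
    TVTendsto l (fun i => μ.tilted (fs i)) μ[|s] := by
  intro gs hgs hgs1
  set Z : ι → ℝ := fun i => ∫ x, Real.exp (fs i x) ∂μ
  have hμs0 : μ.real s ≠ 0 := measureReal_ne_zero_iff (measure_ne_top μ s) |>.2 hμs
  have hnum := tendsto_integral_exp_mul_sub_setIntegral hs hfs hK hmem hnot hgs hgs1
  have hZ : Tendsto Z l (𝓝 (μ.real s)) := by
    have := tendsto_integral_exp_mul_sub_setIntegral hs hfs hK hmem hnot
      (fun _ => measurable_const) (gs := fun _ _ => 1) (by simp)
    simpa [Z] using this.add_const (μ.real s)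
  have hbounded : IsBoundedUnder (· ≤ ·) l fun i => ‖∫ x in s, gs i x ∂μ‖ :=
    isBoundedUnder_of ⟨1 * μ.real s, fun i =>
      norm_setIntegral_le_of_norm_le_const (measure_lt_top μ s) fun x _ => hgs1 i x⟩
  have hinv : Tendsto (fun i => (Z i)⁻¹ - (μ.real s)⁻¹) l (𝓝 0) := by
    simpa using (hZ.inv₀ hμs0).sub_const (μ.real s)⁻¹
  have hsum := (hnum.mul (hZ.inv₀ hμs0)).add (hinv.zero_mul_isBoundedUnder_le hbounded)
  rw [zero_mul, add_zero] at hsum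
  refine hsum.congr fun i => ?_
  have htilted : ∫ x, gs i x ∂μ.tilted (fs i) = (∫ x, Real.exp (fs i x) * gs i x ∂μ) * (Z i)⁻¹ := by
    rw [integral_tilted, ← integral_mul_const]
    exact integral_congr_ae (ae_of_all _ fun x => by simp only [smul_eq_mul]; ring)
  have hcond : ∫ x, gs i x ∂μ[|s] = (∫ x in s, gs i x ∂μ) * (μ.real s)⁻¹ := by
    rw [ProbabilityTheory.cond, integral_smul_measure, ENNReal.toReal_inv, smul_eq_mul, mul_comm,
      measureReal_def]
  rw [htilted, hcond]
  ring

end Laplace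

/-! ### Quantile couplings and Wasserstein distances -/

section Wasserstein

open Set

/-- The quantile function of `μ`, the left-continuous inverse of its distribution function. Only
its values at levels in `(0, 1)` are meaningful. -/
noncomputable def quantile (μ : Measure ℝ) (u : ℝ) : ℝ :=
  sInf {x | u ≤ cdf μ x}

theorem quantile_le_iff (μ : Measure ℝ) {u : ℝ} (hu : u ∈ Ioo 0 1) {x : ℝ} :
    quantile μ u ≤ x ↔ u ≤ cdf μ x := by
  obtain ⟨y, hy⟩ := ((tendsto_cdf_atBot μ).eventually_lt_const hu.1).exists
  have hbdd : BddBelow {x | u ≤ cdf μ x} :=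
    ⟨y, fun z hz => (monotone_cdf μ).reflect_lt (hy.trans_le hz) |>.le⟩
  have hne : {x | u ≤ cdf μ x}.Nonempty :=
    ((tendsto_cdf_atTop μ).eventually_const_lt hu.2).exists.imp fun _ => le_of_lt
  refine ⟨fun h => ?_, fun h => csInf_le hbdd h⟩
  have hright : Tendsto (cdf μ) (𝓝[>] x) (𝓝 (cdf μ x)) :=
    ((cdf μ).right_continuous x).mono_left (nhdsWithin_mono x Ioi_subset_Ici_self)
  refine ge_of_tendsto hright (eventually_mem_nhdsWithin.mono fun y hy => ?_)
  obtain ⟨z, hz, hzy⟩ := exists_lt_of_csInf_lt hne (h.trans_lt hy)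
  exact hz.trans (monotone_cdf μ hzy.le)

theorem lt_quantile_iff (μ : Measure ℝ) {u : ℝ} (hu : u ∈ Ioo 0 1) {x : ℝ} :
    x < quantile μ u ↔ cdf μ x < u := by
  simpa only [not_le] using (quantile_le_iff μ hu).not

theorem monotoneOn_quantile (μ : Measure ℝ) : MonotoneOn (quantile μ) (Ioo 0 1) :=
  fun _ hu _ hv huv => (quantile_le_iff μ hu).2 (huv.trans ((quantile_le_iff μ hv).1 le_rfl))

theorem aemeasurable_quantile (μ : Measure ℝ) :
    AEMeasurable (quantile μ) (volume.restrict (Ioo 0 1)) :=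
  aemeasurable_restrict_of_monotoneOn measurableSet_Ioo (monotoneOn_quantile μ)

theorem map_quantile (μ : Measure ℝ) [IsProbabilityMeasure μ] :
    (volume.restrict (Ioo 0 1)).map (quantile μ) = μ := by
  refine Measure.ext_of_Iic _ _ fun x => ?_
  have hpre : (quantile μ ⁻¹' Iic x : Set ℝ) =ᵐ[volume.restrict (Ioo 0 1)] Iic (cdf μ x) := by
    filter_upwards [ae_restrict_mem measurableSet_Ioo] with u hu
    exact propext (quantile_le_iff μ hu)
  rw [Measure.map_apply_of_aemeasurable (aemeasurable_quantile μ) measurableSet_Iic,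
    measure_congr hpre, Measure.restrict_congr_set Ioo_ae_eq_Ioc,
    Measure.restrict_apply measurableSet_Iic, inter_comm, Ioc_inter_Iic,
    min_eq_right (cdf_le_one μ x), Real.volume_Ioc, sub_zero, ofReal_cdf]

theorem tendsto_quantile {ι : Type*} {l : Filter ι} {μs : ι → ProbabilityMeasure ℝ}
    {μ : ProbabilityMeasure ℝ} (h : Tendsto μs l (𝓝 μ)) {u : ℝ} (hu : u ∈ Ioo 0 1)
    (hcont : ContinuousWithinAt (quantile μ) (Ioo 0 1) u) :
    Tendsto (fun i => quantile (μs i) u) l (𝓝 (quantile μ u)) := by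
  have hdense : Dense {x : ℝ | (μ : Measure ℝ) {x} = 0} := by
    have hcountable := Measure.countable_meas_level_set_pos (μ := (μ : Measure ℝ)) measurable_id
    simpa [compl_ofPred] using hcountable.dense_compl ℝ
  have hcdf {x : ℝ} (hx : (μ : Measure ℝ) {x} = 0) :
      Tendsto (fun i => cdf (μs i) x) l (𝓝 (cdf μ x)) := by
    simp only [cdf_eq_real]
    exact (ENNReal.tendsto_toReal (measure_ne_top _ _)).comp
      (ProbabilityMeasure.tendsto_measure_of_null_frontier_of_tendsto' h (by rwa [frontier_Iic]))
  refine tendsto_order.2 ⟨fun a ha => ?_, fun b hb => ?_⟩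
  · obtain ⟨x, hx, hax, hxu⟩ := hdense.exists_between ha
    filter_upwards [(hcdf hx).eventually_lt_const ((lt_quantile_iff _ hu).1 hxu)] with i hi
    exact hax.trans ((lt_quantile_iff _ hu).2 hi)
  · obtain ⟨v, hvb, hv, huv⟩ : ∃ v, quantile μ v < b ∧ v ∈ Ioo 0 1 ∧ u < v := by
      have hright : ∀ᶠ v in 𝓝[>] u, v ∈ Ioo 0 1 :=
        mem_nhdsWithin_of_mem_nhds (isOpen_Ioo.mem_nhds hu)
      have hlt : ∀ᶠ v in 𝓝[>] u, quantile μ v < b :=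
        nhdsWithin_le_nhds ((hcont.continuousAt (isOpen_Ioo.mem_nhds hu)).eventually_lt_const hb)
      exact (hlt.and (hright.and eventually_mem_nhdsWithin)).exists
    obtain ⟨x, hx, hvx, hxb⟩ := hdense.exists_between hvb
    have hux : u < cdf μ x := huv.trans_le ((quantile_le_iff _ hv).1 hvx.le)
    filter_upwards [(hcdf hx).eventually_const_lt hux] with i hi
    exact ((quantile_le_iff _ hu).2 hi.le).trans_lt hxb

theorem ae_tendsto_quantile {ι : Type*} {l : Filter ι} {μs : ι → ProbabilityMeasure ℝ}
    {μ : ProbabilityMeasure ℝ} (h : Tendsto μs l (𝓝 μ)) :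
    ∀ᵐ u ∂volume.restrict (Ioo 0 1),
      Tendsto (fun i => quantile (μs i) u) l (𝓝 (quantile μ u)) := by
  have hcountable := (monotoneOn_quantile μ).countable_not_continuousWithinAt
  filter_upwards [ae_restrict_mem measurableSet_Ioo, hcountable.ae_notMem _] with u hu hcont
  exact tendsto_quantile h hu (not_not.1 fun hdisc => hcont ⟨hu, hdisc⟩)

theorem wasserstein_le_lintegral_quantile {p : ℝ} (hp : 0 ≤ p) (μ ν : Measure ℝ)
    [IsProbabilityMeasure μ] [IsProbabilityMeasure ν] :
    wasserstein p μ ν ≤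
      (∫⁻ u in Ioo 0 1, edist (quantile μ u) (quantile ν u) ^ p) ^ (1 / p) := by
  have hpair := (aemeasurable_quantile μ).prodMk (aemeasurable_quantile ν)
  refine ENNReal.rpow_le_rpow (iInf₂_le_of_le
    ((volume.restrict (Ioo 0 1)).map fun u => (quantile μ u, quantile ν u)) ⟨?_, ?_⟩ ?_)
    (one_div_nonneg.2 hp)
  · rw [AEMeasurable.map_map_of_aemeasurable measurable_fst.aemeasurable hpair]
    exact map_quantile μ
  · rw [AEMeasurable.map_map_of_aemeasurable measurable_snd.aemeasurable hpair]
    exact map_quantile ν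
  · rw [lintegral_map' (by fun_prop) hpair]

theorem ae_edist_quantile_le {μ ν : Measure ℝ} [IsProbabilityMeasure μ] [IsProbabilityMeasure ν]
    {R : ℝ} (hμ : ∀ᵐ x ∂μ, |x| ≤ R) (hν : ∀ᵐ x ∂ν, |x| ≤ R) :
    ∀ᵐ u ∂volume.restrict (Ioo 0 1),
      edist (quantile μ u) (quantile ν u) ≤ ENNReal.ofReal (R + R) := by
  rw [← map_quantile μ] at hμ
  rw [← map_quantile ν] at hν
  filter_upwards [ae_of_ae_map (aemeasurable_quantile μ) hμ,
    ae_of_ae_map (aemeasurable_quantile ν) hν] with u hu hv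
  rw [edist_dist, Real.dist_eq]
  exact ENNReal.ofReal_le_ofReal ((abs_sub _ _).trans (add_le_add hu hv))

theorem wasserstein_le_of_ae_abs_le {p : ℝ} (hp : 0 < p) {μ ν : Measure ℝ}
    [IsProbabilityMeasure μ] [IsProbabilityMeasure ν] {R : ℝ} (hμ : ∀ᵐ x ∂μ, |x| ≤ R)
    (hν : ∀ᵐ x ∂ν, |x| ≤ R) : wasserstein p μ ν ≤ ENNReal.ofReal (R + R) := by
  calc wasserstein p μ ν
      ≤ (∫⁻ u in Ioo 0 1, edist (quantile μ u) (quantile ν u) ^ p) ^ (1 / p) :=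
        wasserstein_le_lintegral_quantile hp.le μ ν
    _ ≤ (∫⁻ _ in Ioo (0 : ℝ) 1, ENNReal.ofReal (R + R) ^ p) ^ (1 / p) := by
        refine ENNReal.rpow_le_rpow (lintegral_mono_ae ?_) (by positivity)
        filter_upwards [ae_edist_quantile_le hμ hν] with u hu
        gcongr
    _ = ENNReal.ofReal (R + R) := by
        simp [← ENNReal.rpow_mul, hp.ne']

theorem tendsto_wasserstein_of_tendsto {ι : Type*} {l : Filter ι} [l.IsCountablyGenerated]
    {p : ℝ} (hp : 0 < p) {μs : ι → ProbabilityMeasure ℝ} {μ : ProbabilityMeasure ℝ}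
    (h : Tendsto μs l (𝓝 μ)) {R : ℝ} (hμs : ∀ i, ∀ᵐ x ∂(μs i : Measure ℝ), |x| ≤ R)
    (hμ : ∀ᵐ x ∂(μ : Measure ℝ), |x| ≤ R) :
    Tendsto (fun i => wasserstein p (μs i) μ) l (𝓝 0) := by
  have hcost : Tendsto (fun i => ∫⁻ u in Ioo 0 1, edist (quantile (μs i) u) (quantile μ u) ^ p) l
      (𝓝 (∫⁻ _ in Ioo (0 : ℝ) 1, 0)) := by
    refine tendsto_lintegral_filter_of_dominated_convergence' (fun _ => ENNReal.ofReal (R + R) ^ p)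
      (.of_forall fun i => ((aemeasurable_quantile _).edist (aemeasurable_quantile _)).pow_const p)
      (.of_forall fun i => ?_) (by simp [hp.le]) ?_
    · filter_upwards [ae_edist_quantile_le (hμs i) hμ] with u hu
      gcongr
    · filter_upwards [ae_tendsto_quantile h] with u hu
      simpa [hp] using (tendsto_iff_edist_tendsto_0.1 hu).ennrpow_const p
  have hroot := hcost.ennrpow_const (1 / p)
  simp only [lintegral_zero, ENNReal.zero_rpow_of_pos (one_div_pos.2 hp)] at hroot
  exact tendsto_of_tendsto_of_tendsto_of_le_of_le tendsto_const_nhds hroot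
    (fun _ => zero_le) fun i => wasserstein_le_lintegral_quantile hp.le _ _

/-- The integrand of the integrated distance need not be measurable; it is replaced by a measurable
minorant with the same integral. -/
theorem tendsto_integratedWasserstein {ι Y : Type*} [MeasurableSpace Y] {l : Filter ι}
    [l.IsCountablyGenerated] {ω : Measure Y} [IsFiniteMeasure ω] {ζs : ι → Kernel Y ℝ}
    {ζ : Kernel Y ℝ} {p p' : ℝ} (hp' : 0 < p') {K : ℝ≥0∞} (hK : K ≠ ∞)
    (hbound : ∀ i y, wasserstein p (ζs i y) (ζ y) ≤ K)
    (hlim : ∀ y, Tendsto (fun i => wasserstein p (ζs i y) (ζ y)) l (𝓝 0)) :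
    Tendsto (fun i => integratedWasserstein p p' ω (ζs i) ζ) l (𝓝 0) := by
  choose g hg hgle hgint using fun i =>
    exists_measurable_le_lintegral_eq ω fun y => wasserstein p (ζs i y) (ζ y) ^ p'
  have hcost : Tendsto (fun i => ∫⁻ y, g i y ∂ω) l (𝓝 (∫⁻ _, 0 ∂ω)) := by
    refine tendsto_lintegral_filter_of_dominated_convergence (fun _ => K ^ p') (.of_forall hg)
      (.of_forall fun i => ae_of_all _ fun y =>
        (hgle i y).trans (ENNReal.rpow_le_rpow (hbound i y) hp'.le)) ?_ (ae_of_all _ fun y => ?_)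
    · rw [lintegral_const]
      exact ENNReal.mul_ne_top (ENNReal.rpow_ne_top_of_nonneg hp'.le hK) (measure_ne_top ω _)
    · have hpow := (hlim y).ennrpow_const p'
      rw [ENNReal.zero_rpow_of_pos hp'] at hpow
      exact tendsto_of_tendsto_of_tendsto_of_le_of_le tendsto_const_nhds hpow
        (fun _ => zero_le) fun i => hgle i y
  have hroot := hcost.ennrpow_const (1 / p')
  rw [lintegral_zero, ENNReal.zero_rpow_of_pos (one_div_pos.2 hp')] at hroot
  simpa only [integratedWasserstein, hgint] using hroot

end Wasserstein

/-! ### Continuous dependence of return distributions on the policy -/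

section WeakConvergence

variable {ι X : Type*} [MeasurableSpace X] {l : Filter ι}

theorem TVTendsto.tendsto_probabilityMeasure [TopologicalSpace X] [OpensMeasurableSpace X]
    {μs : ι → ProbabilityMeasure X} {μ : ProbabilityMeasure X}
    (h : TVTendsto l (fun i => (μs i : Measure X)) μ) : Tendsto μs l (𝓝 μ) :=
  ProbabilityMeasure.tendsto_iff_forall_integral_tendsto.2 fun f =>
    h.tendsto_integral f.continuous.measurable f.norm_coe_le_norm

theorem dist_integral_le_of_dist_le {μ : Measure X} [IsProbabilityMeasure μ] {f g : X → ℝ}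
    (hf : Integrable f μ) (hg : Integrable g μ) {ε : ℝ} (h : ∀ x, dist (f x) (g x) ≤ ε) :
    dist (∫ x, f x ∂μ) (∫ x, g x ∂μ) ≤ ε := by
  rw [Real.dist_eq, ← integral_sub hf hg]
  exact abs_integral_le_of_abs_le h

theorem tendsto_map_of_tendstoUniformly [l.IsCountablyGenerated] {E : Type*} [PseudoMetricSpace E]
    [MeasurableSpace E] [OpensMeasurableSpace E] {μs : ι → ProbabilityMeasure X}
    {μ : ProbabilityMeasure X} {Gs : ℕ → X → E} {G : X → E} (hGs : ∀ n, Measurable (Gs n))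
    (hG : Measurable G) (hunif : TendstoUniformly Gs G atTop)
    (h : ∀ n, Tendsto (fun i => (μs i).map (hGs n).aemeasurable) l
      (𝓝 (μ.map (hGs n).aemeasurable))) :
    Tendsto (fun i => (μs i).map hG.aemeasurable) l (𝓝 (μ.map hG.aemeasurable)) := by
  rw [tendsto_iff_forall_lipschitz_integral_tendsto]
  rintro f hbounded ⟨L, hL⟩
  have hf : Continuous f := hL.continuous
  have hint (ν : ProbabilityMeasure X) {H : X → E} (hH : Measurable H) :
      Integrable (fun x => f (H x)) (ν : Measure X) :=
    ((BoundedContinuousFunction.mk ⟨f, hf⟩ hbounded).integrable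
      (ν.map hH.aemeasurable : Measure E)).comp_measurable hH
  have hmap (ν : ProbabilityMeasure X) {H : X → E} (hH : Measurable H) :
      ∫ y, f y ∂(ν : Measure X).map H = ∫ x, f (H x) ∂(ν : Measure X) :=
    integral_map hH.aemeasurable hf.measurable.aestronglyMeasurable
  have hintegral : TendstoUniformly
      (fun n (ν : ProbabilityMeasure X) => ∫ x, f (Gs n x) ∂(ν : Measure X))
      (fun ν : ProbabilityMeasure X => ∫ x, f (G x) ∂(ν : Measure X)) atTop := by
    refine Metric.tendstoUniformly_iff.2 fun ε hε => ?_
    filter_upwards [Metric.tendstoUniformly_iff.1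
      (hL.uniformContinuous.comp_tendstoUniformly hunif) (ε / 2) (half_pos hε)] with n hn ν
    exact (dist_integral_le_of_dist_le (hint ν hG) (hint ν (hGs n)) fun x => (hn x).le).trans_lt
      (half_lt_self hε)
  simp only [ProbabilityMeasure.toMeasure_map, hmap _ hG]
  refine TendstoUniformly.tendsto_of_eventually_tendsto
    (hintegral.comp μs) (.of_forall fun n => ?_) (hintegral.tendsto_at μ)
  simpa only [ProbabilityMeasure.toMeasure_map, hmap _ (hGs n), Function.comp_def] using
    tendsto_iff_forall_lipschitz_integral_tendsto.1 (h n) f hbounded ⟨L, hL⟩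

end WeakConvergence

namespace MDP

section Return

variable {S A : Type*} [MeasurableSpace S] [MeasurableSpace A] (M : MDP S A)

/-- The discounted return of the first `n` steps; it depends on finitely many coordinates and
approximates `discountedReturn` uniformly. -/
noncomputable def truncatedReturn (n : ℕ) (w : ℕ → S × A) : ℝ :=
  ∑ t ∈ Finset.range n, M.γ ^ t * M.r (w t)

theorem measurable_truncatedReturn (n : ℕ) : Measurable (M.truncatedReturn n) :=
  Finset.measurable_sum _ fun t _ => (M.measurable_r.comp (measurable_pi_apply t)).const_mul _

theorem norm_discounted_reward_le {C : ℝ} (hC : ∀ z, |M.r z| ≤ C) (t : ℕ) (z : S × A) :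
    ‖M.γ ^ t * M.r z‖ ≤ C * M.γ ^ t := by
  rw [norm_mul, Real.norm_of_nonneg (pow_nonneg M.γ_pos.le t), mul_comm]
  exact mul_le_mul_of_nonneg_right (hC z) (pow_nonneg M.γ_pos.le t)

theorem hasSum_discounted_bound (C : ℝ) : HasSum (fun t => C * M.γ ^ t) (C / (1 - M.γ)) :=
  (hasSum_geometric_of_lt_one M.γ_pos.le M.γ_lt_one).mul_left C

theorem tendstoUniformly_truncatedReturn :
    TendstoUniformly M.truncatedReturn M.discountedReturn atTop := by
  obtain ⟨C, hC⟩ := M.bounded_r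
  exact tendstoUniformly_tsum_nat (M.hasSum_discounted_bound C).summable
    fun t w => M.norm_discounted_reward_le hC t (w t)

theorem measurable_discountedReturn : Measurable M.discountedReturn :=
  measurable_of_tendsto_metrizable M.measurable_truncatedReturn
    (tendsto_pi_nhds.2 M.tendstoUniformly_truncatedReturn.tendsto_at)

theorem exists_abs_discountedReturn_le : ∃ R, ∀ w, |M.discountedReturn w| ≤ R := by
  obtain ⟨C, hC⟩ := M.bounded_r
  exact ⟨_, fun w => tsum_of_norm_bounded (M.hasSum_discounted_bound C)
    fun t => M.norm_discounted_reward_le hC t (w t)⟩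

instance isMarkovKernel_trajKernel (π : Kernel S A) [IsMarkovKernel π] :
    IsMarkovKernel (M.trajKernel π) := by
  unfold trajKernel; infer_instance

instance isMarkovKernel_returnDist (π : Kernel S A) [IsMarkovKernel π] :
    IsMarkovKernel (M.returnDist π) :=
  Kernel.IsMarkovKernel.map _ M.measurable_discountedReturn

theorem returnDist_apply (π : Kernel S A) [IsMarkovKernel π] (z : S × A) :
    M.returnDist π z = (M.trajKernel π z).map M.discountedReturn :=
  Kernel.map_apply _ M.measurable_discountedReturn z

theorem exists_forall_ae_abs_returnDist_le : ∃ R : ℝ, ∀ (π : Kernel S A) [IsMarkovKernel π] z,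
    ∀ᵐ x ∂M.returnDist π z, |x| ≤ R := by
  obtain ⟨R, hR⟩ := M.exists_abs_discountedReturn_le
  refine ⟨R, fun π _ z => ?_⟩
  rw [returnDist_apply, ae_map_iff M.measurable_discountedReturn.aemeasurable
    (measurableSet_le measurable_abs measurable_const)]
  exact ae_of_all _ hR

variable {ι : Type*} {l : Filter ι} [l.IsCountablyGenerated] {πs : ι → Kernel S A}
  {π : Kernel S A} [∀ i, IsMarkovKernel (πs i)] [IsMarkovKernel π]

theorem tvTendsto_stepKernel (h : ∀ x, TVTendsto l (fun i => πs i x) (π x)) (z : S × A) :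
    TVTendsto l (fun i => M.stepKernel (πs i) z) (M.stepKernel π z) := by
  simp only [stepKernel, Kernel.compProd_apply_eq_compProd_sectR]
  refine (TVTendsto.const _).compProd fun x => ?_
  simpa using h x

theorem tvTendsto_trajKernel_map_frestrictLe (h : ∀ x, TVTendsto l (fun i => πs i x) (π x))
    (z : S × A) (n : ℕ) :
    TVTendsto l (fun i => (M.trajKernel (πs i) z).map (Preorder.frestrictLe n))
      ((M.trajKernel π z).map (Preorder.frestrictLe n)) := by
  have hpartial (η : Kernel S A) [IsMarkovKernel η] :
      (M.trajKernel η z).map (Preorder.frestrictLe n) =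
        Kernel.partialTraj (X := fun _ => S × A) (M.historyKernel η) 0 n fun _ => z :=
    Kernel.traj_map_frestrictLe_apply 0 n _
  simp only [hpartial]
  exact TVTendsto.partialTraj (fun _ _ => M.tvTendsto_stepKernel h _) n.zero_le _

theorem tvTendsto_trajKernel_map_truncatedReturn
    (h : ∀ x, TVTendsto l (fun i => πs i x) (π x)) (z : S × A) (n : ℕ) :
    TVTendsto l (fun i => (M.trajKernel (πs i) z).map (M.truncatedReturn n))
      ((M.trajKernel π z).map (M.truncatedReturn n)) := by
  let freeze (v : (i : Finset.Iic n) → S × A) (t : ℕ) : S × A :=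
    v ⟨min t n, Finset.mem_Iic.2 (min_le_right t n)⟩
  have hfreeze : Measurable freeze := measurable_pi_lambda _ fun t => measurable_pi_apply _
  have hfactor : M.truncatedReturn n =
      (M.truncatedReturn n ∘ freeze) ∘ Preorder.frestrictLe n := by
    ext w
    refine Finset.sum_congr rfl fun t ht => ?_
    simp [freeze, min_eq_left (Finset.mem_range.1 ht).le]
  have hmeas := (M.measurable_truncatedReturn n).comp hfreeze
  rw [hfactor]
  simp only [← Measure.map_map hmeas
    (Preorder.measurable_frestrictLe (X := fun _ => S × A) n)]
  exact (M.tvTendsto_trajKernel_map_frestrictLe h z n).map hmeas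

theorem tendsto_returnDist (h : ∀ x, TVTendsto l (fun i => πs i x) (π x)) (z : S × A) :
    Tendsto (β := ProbabilityMeasure ℝ) (fun i => ⟨M.returnDist (πs i) z, inferInstance⟩) l
      (𝓝 ⟨M.returnDist π z, inferInstance⟩) := by
  simp only [returnDist_apply]
  exact tendsto_map_of_tendstoUniformly (μs := fun i => ⟨M.trajKernel (πs i) z, inferInstance⟩)
    (μ := ⟨M.trajKernel π z, inferInstance⟩) M.measurable_truncatedReturn
    M.measurable_discountedReturn M.tendstoUniformly_truncatedReturn
    fun n => (M.tvTendsto_trajKernel_map_truncatedReturn h z n).tendsto_probabilityMeasure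

theorem tendsto_integratedWasserstein_returnDist (h : ∀ x, TVTendsto l (fun i => πs i x) (π x))
    {p p' : ℝ} (hp : 0 < p) (hp' : 0 < p') (ω : Measure (S × A)) [IsFiniteMeasure ω] :
    Tendsto (fun i => integratedWasserstein p p' ω (M.returnDist (πs i)) (M.returnDist π)) l
      (𝓝 0) := by
  obtain ⟨R, hR⟩ := M.exists_forall_ae_abs_returnDist_le
  refine tendsto_integratedWasserstein hp' ENNReal.ofReal_ne_top
    (fun i z => wasserstein_le_of_ae_abs_le hp (hR (πs i) z) (hR π z)) fun z => ?_
  exact tendsto_wasserstein_of_tendsto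
    (μs := fun i => ⟨M.returnDist (πs i) z, inferInstance⟩)
    (μ := ⟨M.returnDist π z, inferInstance⟩) hp (M.tendsto_returnDist h z)
    (fun i => hR (πs i) z) (hR π z)

end Return

end MDP

/-! ### Bounded measurable functions -/

/-- Bounded measurable real functions, the space on which the Bellman operators act. -/
structure IsBddMeasurable {X : Type*} [MeasurableSpace X] (f : X → ℝ) : Prop where
  measurable : Measurable f
  exists_abs_le : ∃ C, ∀ x, |f x| ≤ C

section BoundedMeasurable

variable {X Y : Type*} [MeasurableSpace X] [MeasurableSpace Y]

namespace IsBddMeasurable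

variable {f : X → ℝ} {μ : Measure X}

theorem integrable [IsFiniteMeasure μ] (hf : IsBddMeasurable f) : Integrable f μ :=
  hf.exists_abs_le.elim fun _ => integrable_of_measurable_of_abs_le hf.measurable

theorem const (c : ℝ) : IsBddMeasurable fun _ : X => c :=
  ⟨measurable_const, |c|, fun _ => le_rfl⟩

theorem comp_prodMk_left {q : Y × X → ℝ} (hq : IsBddMeasurable q) (y : Y) :
    IsBddMeasurable fun x => q (y, x) :=
  ⟨hq.measurable.comp measurable_prodMk_left, hq.exists_abs_le.imp fun _ hC x => hC (y, x)⟩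

theorem exp_div (hf : IsBddMeasurable f) {τ : ℝ} (hτ : 0 < τ) :
    IsBddMeasurable fun x => Real.exp (f x / τ) := by
  obtain ⟨hfm, C, hC⟩ := hf
  refine ⟨by fun_prop, Real.exp (C / τ), fun x => ?_⟩
  rw [Real.abs_exp]
  gcongr
  exact (le_abs_self _).trans (hC x)

theorem isBoundedUnder_ae (hf : IsBddMeasurable f) : IsBoundedUnder (· ≤ ·) (ae μ) f :=
  hf.exists_abs_le.elim fun C hC => isBoundedUnder_of ⟨C, fun x => (le_abs_self _).trans (hC x)⟩

theorem ae_le_essSup (hf : IsBddMeasurable f) : ∀ᵐ x ∂μ, f x ≤ essSup f μ :=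
  _root_.ae_le_essSup hf.isBoundedUnder_ae

theorem essSup_le_iff [NeZero μ] (hf : IsBddMeasurable f) {c : ℝ} :
    essSup f μ ≤ c ↔ ∀ᵐ x ∂μ, f x ≤ c := by
  obtain ⟨C, hC⟩ := hf.exists_abs_le
  exact ⟨fun h => hf.ae_le_essSup.mono fun _ hx => hx.trans h, fun h => essSup_le_of_ae_le c h
    (isBoundedUnder_of ⟨-C, fun x => (abs_le.1 (hC x)).1⟩).isCoboundedUnder_le⟩

theorem essSup_le_essSup_add [NeZero μ] {g : X → ℝ} (hf : IsBddMeasurable f)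
    (hg : IsBddMeasurable g) {c : ℝ} (h : ∀ᵐ x ∂μ, f x ≤ g x + c) :
    essSup f μ ≤ essSup g μ + c := by
  rw [hf.essSup_le_iff]
  filter_upwards [h, hg.ae_le_essSup] with x hx hgx
  linarith

theorem measure_eq_essSup_eq (hf : IsBddMeasurable f) :
    μ {x | f x = essSup f μ} = μ {x | essSup f μ ≤ f x} :=
  measure_congr <| hf.ae_le_essSup.mono fun _ hx => propext ⟨Eq.ge, hx.antisymm⟩

theorem le_measure_eq_essSup [IsFiniteMeasure μ] (hf : IsBddMeasurable f) {m : ℝ≥0∞}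
    (h : ∀ ε > 0, m ≤ μ {x | essSup f μ - ε ≤ f x}) : m ≤ μ {x | f x = essSup f μ} := by
  have hlim := tendsto_measure_biInter_gt (μ := μ) (a := (0 : ℝ))
    (s := fun ε => {x | essSup f μ - ε ≤ f x})
    (fun ε _ => (measurableSet_le measurable_const hf.measurable).nullMeasurableSet)
    (fun ε ε' _ hε x hx => (sub_le_sub_left hε _).trans hx) ⟨1, one_pos, measure_ne_top _ _⟩
  have hinter : ⋂ ε > (0 : ℝ), {x | essSup f μ - ε ≤ f x} = {x | essSup f μ ≤ f x} := by
    ext x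
    simp only [Set.mem_iInter, Set.mem_ofPred_eq, sub_le_iff_le_add]
    exact le_iff_forall_pos_le_add.symm
  rw [hf.measure_eq_essSup_eq, ← hinter]
  exact ge_of_tendsto hlim (eventually_mem_nhdsWithin.mono h)

end IsBddMeasurable

theorem tilted_sub_const (μ : Measure X) (f : X → ℝ) (c : ℝ) :
    μ.tilted (fun x => f x - c) = μ.tilted f := by
  simp only [Measure.tilted, Real.exp_sub, integral_div,
    div_div_div_cancel_right₀ (Real.exp_ne_zero c)]

theorem isClosed_setOf_isBddMeasurable :
    IsClosed {f : UniformFun X ℝ | IsBddMeasurable (UniformFun.toFun f)} := by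
  refine IsSeqClosed.isClosed fun fs f hfs hlim => ?_
  rw [UniformFun.tendsto_iff_tendstoUniformly] at hlim
  refine ⟨measurable_of_tendsto_metrizable (fun n => (hfs n).measurable)
    (tendsto_pi_nhds.2 hlim.tendsto_at), ?_⟩
  obtain ⟨n, hn⟩ := (Metric.tendstoUniformly_iff.1 hlim 1 one_pos).exists
  obtain ⟨C, hC⟩ := (hfs n).exists_abs_le
  refine ⟨1 + C, fun x => ?_⟩
  calc |UniformFun.toFun f x|
      ≤ |UniformFun.toFun f x - UniformFun.toFun (fs n) x| + |UniformFun.toFun (fs n) x| :=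
        sub_le_iff_le_add.1 (abs_sub_abs_le_abs_sub _ _)
    _ ≤ 1 + C := add_le_add (hn x).le (hC x)

theorem IsBddMeasurable.edist_ofFun_ne_top {f g : X → ℝ} (hf : IsBddMeasurable f)
    (hg : IsBddMeasurable g) : edist (UniformFun.ofFun f) (UniformFun.ofFun g) ≠ ∞ := by
  obtain ⟨C, hC⟩ := hf.exists_abs_le
  obtain ⟨D, hD⟩ := hg.exists_abs_le
  refine ne_top_of_le_ne_top (b := ENNReal.ofReal (C + D)) ENNReal.ofReal_ne_top
    (UniformFun.edist_le.2 fun x => ?_)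
  rw [edist_dist]
  exact ENNReal.ofReal_le_ofReal ((abs_sub _ _).trans (add_le_add (hC x) (hD x)))

/-- Banach's theorem in `UniformFun X ℝ`, where the bounded measurable functions form a closed set
of points at finite distance from each other. -/
theorem exists_isBddMeasurable_eq_of_contracting {T : (X → ℝ) → X → ℝ} {k : NNReal} (hk : k < 1)
    (hT : ∀ f, IsBddMeasurable f → IsBddMeasurable (T f))
    (hcontr : ∀ f g, IsBddMeasurable f → IsBddMeasurable g → ∀ c, (∀ x, |f x - g x| ≤ c) →
      ∀ x, |T f x - T g x| ≤ k * c) :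
    ∃ f, IsBddMeasurable f ∧ T f = f := by
  have hzero : IsBddMeasurable (fun _ : X => (0 : ℝ)) := .const 0
  let s : Set (UniformFun X ℝ) := {f | IsBddMeasurable (UniformFun.toFun f)}
  let Φ (f : UniformFun X ℝ) : UniformFun X ℝ := UniformFun.ofFun (T (UniformFun.toFun f))
  have hmaps : Set.MapsTo Φ s s := fun f hf => hT _ hf
  have hcontracting : ContractingWith k (hmaps.restrict Φ s s) := by
    refine ⟨hk, fun f g => UniformFun.edist_le.2 fun x => ?_⟩
    have hne : edist f.1 g.1 ≠ ∞ := f.2.edist_ofFun_ne_top g.2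
    have hdist (y : X) : |UniformFun.toFun f.1 y - UniformFun.toFun g.1 y| ≤
        (edist f.1 g.1).toReal := by
      rw [← Real.dist_eq, dist_edist]
      exact ENNReal.toReal_mono hne UniformFun.edist_eval_le
    calc edist (T (UniformFun.toFun f.1) x) (T (UniformFun.toFun g.1) x)
        ≤ ENNReal.ofReal (k * (edist f.1 g.1).toReal) := by
          rw [edist_dist]
          exact ENNReal.ofReal_le_ofReal (hcontr _ _ f.2 g.2 _ hdist x)
      _ = k * edist f.1 g.1 := by
          rw [ENNReal.ofReal_mul k.coe_nonneg, ENNReal.ofReal_coe_nnreal, ENNReal.ofReal_toReal hne]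
  obtain ⟨f, hf, hfix, -⟩ := hcontracting.exists_fixedPoint'
    isClosed_setOf_isBddMeasurable.isComplete hmaps hzero (hzero.edist_ofFun_ne_top (hT _ hzero))
  exact ⟨_, hf, hfix⟩

end BoundedMeasurable

theorem le_div_one_sub_of_forall_le {X : Type*} {f : X → ℝ} (hf : BddAbove (Set.range f))
    {a k : ℝ} (hk : k < 1) (h : ∀ c, (∀ x, f x ≤ c) → ∀ x, f x ≤ a + k * c) (x : X) :
    f x ≤ a / (1 - k) := by
  have : Nonempty X := ⟨x⟩
  have hsup := ciSup_le (h _ (le_ciSup hf))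
  refine (le_ciSup hf x).trans ((le_div_iff₀ (sub_pos.2 hk)).2 ?_)
  linarith

namespace MDP

variable {S A : Type*} [MeasurableSpace S] [MeasurableSpace A]

/-! ### Bellman operators and their fixed points -/

section Bellman

variable (M : MDP S A)

/-- The one-step Bellman backup of a state-value function; the two Bellman operators are
`M.backup ∘ V` for `V` the soft value `vLSE πref τ` and the essential supremum. -/
noncomputable def backup (v : S → ℝ) (z : S × A) : ℝ := M.r z + M.γ * ∫ x, v x ∂M.P z

theorem isBddMeasurable_backup {v : S → ℝ} (hv : IsBddMeasurable v) :
    IsBddMeasurable (M.backup v) := by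
  obtain ⟨R, hR⟩ := M.bounded_r
  obtain ⟨hvm, C, hC⟩ := hv
  refine ⟨M.measurable_r.add (hvm.stronglyMeasurable.integral_kernel.measurable.const_mul _),
    R + M.γ * C, fun z => (abs_add_le _ _).trans (add_le_add (hR z) ?_)⟩
  rw [abs_mul, abs_of_pos M.γ_pos]
  exact mul_le_mul_of_nonneg_left (abs_integral_le_of_abs_le hC) M.γ_pos.le

theorem abs_backup_sub_le {v w : S → ℝ} (hv : IsBddMeasurable v) (hw : IsBddMeasurable w) {c : ℝ}
    (h : ∀ x, |v x - w x| ≤ c) (z : S × A) : |M.backup v z - M.backup w z| ≤ M.γ * c := by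
  calc |M.backup v z - M.backup w z| = M.γ * |∫ x, (v x - w x) ∂M.P z| := by
        rw [integral_sub hv.integrable hw.integrable, backup, backup, add_sub_add_left_eq_sub,
          ← mul_sub, abs_mul, abs_of_pos M.γ_pos]
    _ ≤ M.γ * c := mul_le_mul_of_nonneg_left (abs_integral_le_of_abs_le h) M.γ_pos.le

/-- A state-value operator satisfying Blackwell's conditions on bounded measurable functions
(monotonicity and subadditivity with respect to constants, merged into `le_add`) and vanishing at
`0`. -/
structure IsValueOperator (V : (S × A → ℝ) → S → ℝ) : Prop where
  measurable : ∀ {q}, IsBddMeasurable q → Measurable (V q)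
  le_add : ∀ {q q'}, IsBddMeasurable q → IsBddMeasurable q' → ∀ {c}, (∀ z, q z ≤ q' z + c) →
    ∀ x, V q x ≤ V q' x + c
  map_zero : ∀ x, V (fun _ => 0) x = 0

namespace IsValueOperator

variable {V : (S × A → ℝ) → S → ℝ}

theorem abs_sub_le (hV : IsValueOperator V) {q q' : S × A → ℝ} (hq : IsBddMeasurable q)
    (hq' : IsBddMeasurable q') {c : ℝ} (h : ∀ z, |q z - q' z| ≤ c) (x : S) :
    |V q x - V q' x| ≤ c := by
  have hle := hV.le_add hq hq' (fun z => by linarith [(abs_le.1 (h z)).2]) x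
  have hge := hV.le_add hq' hq (fun z => by linarith [(abs_le.1 (h z)).1]) x
  exact abs_le.2 ⟨by linarith, by linarith⟩

theorem isBddMeasurable (hV : IsValueOperator V) {q : S × A → ℝ} (hq : IsBddMeasurable q) :
    IsBddMeasurable (V q) := by
  refine ⟨hV.measurable hq, hq.exists_abs_le.imp fun C hC x => ?_⟩
  simpa only [hV.map_zero, sub_zero] using
    hV.abs_sub_le hq (.const 0) (fun z => by simpa only [sub_zero] using hC z) x

theorem exists_isBddFixedPoint (hV : IsValueOperator V) :
    ∃ q, IsBddFixedPoint (fun q => M.backup (V q)) q := by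
  obtain ⟨q, hq, hfix⟩ := exists_isBddMeasurable_eq_of_contracting
    (T := fun q => M.backup (V q)) (k := ⟨M.γ, M.γ_pos.le⟩) M.γ_lt_one
    (fun q hq => M.isBddMeasurable_backup (hV.isBddMeasurable hq))
    fun q q' hq hq' c h => M.abs_backup_sub_le (hV.isBddMeasurable hq) (hV.isBddMeasurable hq')
      (hV.abs_sub_le hq hq' h)
  exact ⟨q, hq.measurable, hq.exists_abs_le, hfix⟩

end IsValueOperator

end Bellman

theorem measurableSet_optActions {πref : Kernel S A} {q : S × A → ℝ} (hq : Measurable q) (x : S) :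
    MeasurableSet (optActions πref q x) :=
  measurableSet_eq_fun (hq.comp measurable_prodMk_left) measurable_const

section ValueOperators

variable {πref : Kernel S A} [IsMarkovKernel πref] {q : S × A → ℝ}

theorem measurable_essSup (hq : IsBddMeasurable q) :
    Measurable fun x => essSup (fun a => q (x, a)) (πref x) := by
  refine measurable_of_Iic fun c => ?_
  have hpreimage : (fun x => essSup (fun a => q (x, a)) (πref x)) ⁻¹' Set.Iic c =
      (fun x => πref x (Prod.mk x ⁻¹' {z | c < q z})) ⁻¹' {0} := by
    ext x
    simp [(hq.comp_prodMk_left x).essSup_le_iff, ae_iff]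
  rw [hpreimage]
  exact Kernel.measurable_kernel_prodMk_left (measurableSet_lt measurable_const hq.measurable)
    (measurableSet_singleton 0)

theorem isValueOperator_essSup :
    IsValueOperator fun (q : S × A → ℝ) x => essSup (fun a => q (x, a)) (πref x) where
  measurable := measurable_essSup
  le_add hq hq' _ h x := (hq.comp_prodMk_left x).essSup_le_essSup_add
    (hq'.comp_prodMk_left x) (ae_of_all _ fun a => h (x, a))
  map_zero _ := essSup_const' 0

theorem integrable_exp_div (hq : IsBddMeasurable q) {τ : ℝ} (hτ : 0 < τ) (x : S) :
    Integrable (fun a => Real.exp (q (x, a) / τ)) (πref x) :=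
  ((hq.exp_div hτ).comp_prodMk_left x).integrable

theorem exp_vLSE_div (hq : IsBddMeasurable q) {τ : ℝ} (hτ : 0 < τ) (x : S) :
    Real.exp (vLSE πref τ q x / τ) = ∫ a, Real.exp (q (x, a) / τ) ∂πref x := by
  rw [vLSE, mul_div_cancel_left₀ _ hτ.ne', Real.exp_log (integral_exp_pos
    (integrable_exp_div hq hτ x))]

theorem measurable_vLSE (hq : Measurable q) (τ : ℝ) : Measurable (vLSE πref τ q) := by
  have hexp : Measurable fun z : S × A => Real.exp (q z / τ) := by fun_prop
  exact hexp.stronglyMeasurable.integral_kernel_prod_right'.measurable.log.const_mul τ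

theorem vLSE_le_iff (hq : IsBddMeasurable q) {τ : ℝ} (hτ : 0 < τ) {x : S} {c : ℝ} :
    vLSE πref τ q x ≤ c ↔ ∫ a, Real.exp (q (x, a) / τ) ∂πref x ≤ Real.exp (c / τ) := by
  rw [← exp_vLSE_div hq hτ, Real.exp_le_exp, div_le_div_iff_of_pos_right hτ]

theorem vLSE_le_add {q' : S × A → ℝ} (hq : IsBddMeasurable q) (hq' : IsBddMeasurable q') {τ : ℝ}
    (hτ : 0 < τ) {c : ℝ} {x : S} (h : ∀ᵐ a ∂πref x, q (x, a) ≤ q' (x, a) + c) :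
    vLSE πref τ q x ≤ vLSE πref τ q' x + c := by
  rw [vLSE_le_iff hq hτ, add_div, Real.exp_add, exp_vLSE_div hq' hτ, ← integral_mul_const]
  refine integral_mono_ae (integrable_exp_div hq hτ x)
    ((integrable_exp_div hq' hτ x).mul_const _) ?_
  filter_upwards [h] with a ha
  rw [← Real.exp_add, ← add_div]
  gcongr

theorem isValueOperator_vLSE {τ : ℝ} (hτ : 0 < τ) :
    IsValueOperator (vLSE πref τ) where
  measurable hq := measurable_vLSE hq.measurable τ
  le_add hq hq' _ h x := vLSE_le_add hq hq' hτ (ae_of_all _ fun a => h (x, a))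
  map_zero x := by simp [vLSE]

theorem vLSE_le_essSup (hq : IsBddMeasurable q) {τ : ℝ} (hτ : 0 < τ) (x : S) :
    vLSE πref τ q x ≤ essSup (fun a => q (x, a)) (πref x) := by
  have h := vLSE_le_add (πref := πref) (x := x) (q' := fun _ => 0) hq
    (.const 0) hτ ((hq.comp_prodMk_left x).ae_le_essSup.mono fun a ha => by simpa using ha)
  simpa [(isValueOperator_vLSE hτ).map_zero] using h

/-- The optimal actions alone already contribute this much to the integral. -/
theorem essSup_add_log_le_vLSE (hq : IsBddMeasurable q) {τ : ℝ} (hτ : 0 < τ) {x : S} {δ : ℝ}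
    (hδ : 0 < δ) (h : δ ≤ (πref x).real (optActions πref q x)) :
    essSup (fun a => q (x, a)) (πref x) + τ * Real.log δ ≤ vLSE πref τ q x := by
  set e := essSup (fun a => q (x, a)) (πref x)
  rw [← div_le_div_iff_of_pos_right hτ, ← Real.exp_le_exp, exp_vLSE_div hq hτ]
  calc Real.exp ((e + τ * Real.log δ) / τ) = Real.exp (e / τ) * δ := by
        rw [add_div, mul_div_cancel_left₀ _ hτ.ne', Real.exp_add, Real.exp_log hδ]
    _ ≤ Real.exp (e / τ) * (πref x).real (optActions πref q x) := by gcongr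
    _ = ∫ _ in optActions πref q x, Real.exp (e / τ) ∂πref x := by
        rw [setIntegral_const, smul_eq_mul, mul_comm]
    _ = ∫ a in optActions πref q x, Real.exp (q (x, a) / τ) ∂πref x :=
        setIntegral_congr_fun (measurableSet_optActions hq.measurable x)
          fun _ (ha : q _ = e) => by simp only [ha]
    _ ≤ ∫ a, Real.exp (q (x, a) / τ) ∂πref x :=
        setIntegral_le_integral (integrable_exp_div hq hτ x)
          (ae_of_all _ fun _ => (Real.exp_pos _).le)

end ValueOperators

section FixedPoints

variable (M : MDP S A) (πref : Kernel S A) [IsMarkovKernel πref]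

theorem isBddFixedPoint_qSoft {τ : ℝ} (hτ : 0 < τ) :
    IsBddFixedPoint (M.softBellman πref τ) (M.qSoft πref τ) :=
  Classical.epsilon_spec ((isValueOperator_vLSE hτ).exists_isBddFixedPoint M)

theorem isBddFixedPoint_qRef : IsBddFixedPoint (M.refBellman πref) (M.qRef πref) :=
  Classical.epsilon_spec (isValueOperator_essSup.exists_isBddFixedPoint M)

theorem isBddMeasurable_qSoft {τ : ℝ} (hτ : 0 < τ) : IsBddMeasurable (M.qSoft πref τ) :=
  let ⟨hmeas, hbdd, _⟩ := M.isBddFixedPoint_qSoft πref hτ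
  ⟨hmeas, hbdd⟩

theorem isBddMeasurable_qRef : IsBddMeasurable (M.qRef πref) :=
  let ⟨hmeas, hbdd, _⟩ := M.isBddFixedPoint_qRef πref
  ⟨hmeas, hbdd⟩

theorem qSoft_eq_backup {τ : ℝ} (hτ : 0 < τ) :
    M.qSoft πref τ = M.backup (vLSE πref τ (M.qSoft πref τ)) :=
  (M.isBddFixedPoint_qSoft πref hτ).2.2.symm

theorem qRef_eq_backup :
    M.qRef πref = M.backup fun x => essSup (fun a => M.qRef πref (x, a)) (πref x) :=
  (M.isBddFixedPoint_qRef πref).2.2.symm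

variable {πref}

theorem abs_qSoft_sub_qRef_le {δ : ℝ} (hδ : 0 < δ) {τ : ℝ} (hτ : 0 < τ)
    (hcov : ∀ x, δ ≤ (πref x).real (optActions πref (M.qSoft πref τ) x)) (z : S × A) :
    |M.qSoft πref τ z - M.qRef πref z| ≤ M.γ * (τ * -Real.log δ) / (1 - M.γ) := by
  have hq := M.isBddMeasurable_qSoft πref hτ
  have hq' := M.isBddMeasurable_qRef πref
  have hbdd : BddAbove (Set.range fun z => |M.qSoft πref τ z - M.qRef πref z|) := by
    obtain ⟨C, hC⟩ := hq.exists_abs_le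
    obtain ⟨C', hC'⟩ := hq'.exists_abs_le
    exact ⟨C + C', Set.forall_mem_range.2 fun z =>
      (abs_sub _ _).trans (add_le_add (hC z) (hC' z))⟩
  refine le_div_one_sub_of_forall_le hbdd M.γ_lt_one (fun c hc z => ?_) z
  rw [M.qSoft_eq_backup πref hτ, M.qRef_eq_backup πref, ← mul_add]
  refine M.abs_backup_sub_le ((isValueOperator_vLSE hτ).isBddMeasurable hq)
    (isValueOperator_essSup.isBddMeasurable hq') (fun x => ?_) z
  have hupper := vLSE_le_essSup (πref := πref) hq hτ x
  have hlower := essSup_add_log_le_vLSE hq hτ hδ (hcov x)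
  have hsup := abs_le.1 ((isValueOperator_essSup (πref := πref)).abs_sub_le hq hq' hc x)
  have hlog : Real.log δ ≤ 0 := Real.log_nonpos hδ.le ((hcov x).trans measureReal_le_one)
  have hτlog := mul_nonpos_of_nonneg_of_nonpos hτ.le hlog
  exact abs_le.2 ⟨by linarith, by linarith [hτlog]⟩

theorem exists_abs_qSoft_sub_qRef_le (hcov : M.Coverage πref) :
    ∃ K : ℝ, ∀ τ : ℝ, 0 < τ → ∀ z, |M.qSoft πref τ z - M.qRef πref z| ≤ K * τ := by
  obtain ⟨pmin, hpos, hp⟩ := hcov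
  obtain ⟨δ, hδ, hδp⟩ : ∃ δ : ℝ, 0 < δ ∧ ENNReal.ofReal δ ≤ pmin := by
    obtain ⟨δ, -, hδ, hδp⟩ := ENNReal.lt_iff_exists_real_btwn.1 hpos
    exact ⟨δ, ENNReal.ofReal_pos.1 hδ, hδp.le⟩
  refine ⟨M.γ * -Real.log δ / (1 - M.γ), fun τ hτ z => ?_⟩
  have hδcov (x : S) : δ ≤ (πref x).real (optActions πref (M.qSoft πref τ) x) :=
    (ENNReal.ofReal_le_iff_le_toReal (measure_ne_top _ _)).1 (hδp.trans (hp τ hτ x))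
  exact (M.abs_qSoft_sub_qRef_le hδ hτ hδcov z).trans_eq (by ring)

end FixedPoints

/-! ### Boltzmann policies at vanishing temperature -/

section Policies

theorem toPolicy_apply_of_measure_univ (πref κ : Kernel S A) {x : S}
    (h : κ x Set.univ = 1) : toPolicy πref κ x = κ x := by
  classical
  rw [toPolicy, Kernel.piecewise_apply, if_pos]
  exact h

variable {πref : Kernel S A} [IsMarkovKernel πref] {q : S × A → ℝ}

theorem measure_optActions_qRef_ne_zero (M : MDP S A) (hcov : M.Coverage πref) (x : S) :
    πref x (optActions πref (M.qRef πref) x) ≠ 0 := by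
  obtain ⟨K, hK⟩ := M.exists_abs_qSoft_sub_qRef_le hcov
  obtain ⟨pmin, hpos, hp⟩ := hcov
  have hq' := M.isBddMeasurable_qRef πref
  refine (hpos.trans_le ((hq'.comp_prodMk_left x).le_measure_eq_essSup fun ε hε => ?_)).ne'
  obtain ⟨τ, hτ, hKτ⟩ : ∃ τ : ℝ, 0 < τ ∧ 2 * (K * τ) ≤ ε := by
    have hlim : Tendsto (fun τ => 2 * (K * τ)) (𝓝[>] 0) (𝓝 0) := by
      have hcont : Continuous fun τ => 2 * (K * τ) := by fun_prop
      exact tendsto_nhdsWithin_of_tendsto_nhds (by simpa using hcont.tendsto 0)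
    exact (eventually_mem_nhdsWithin.and (hlim.eventually_le_const hε)).exists
  refine (hp τ hτ x).trans (measure_mono fun a (ha : M.qSoft πref τ (x, a) = _) => ?_)
  have hsup := abs_le.1 ((isValueOperator_essSup (πref := πref)).abs_sub_le
    (M.isBddMeasurable_qSoft πref hτ) hq' (hK τ hτ) x)
  have hdist := abs_le.1 (hK τ hτ (x, a))
  rw [Set.mem_ofPred_eq]
  linarith

theorem boltzmann_apply (hq : IsBddMeasurable q) {τ : ℝ} (hτ : 0 < τ) (x : S) :
    boltzmann πref τ q x = (πref x).tilted fun a => q (x, a) / τ := by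
  have hdensity : Measurable (Function.uncurry fun x a =>
      ENNReal.ofReal (Real.exp ((q (x, a) - vLSE πref τ q x) / τ))) :=
    ((hq.measurable.sub ((measurable_vLSE hq.measurable τ).comp measurable_fst)).div_const
      τ).exp.ennreal_ofReal
  have htilted : πref.withDensity (fun x a =>
      ENNReal.ofReal (Real.exp ((q (x, a) - vLSE πref τ q x) / τ))) x =
        (πref x).tilted fun a => q (x, a) / τ := by
    rw [Kernel.withDensity_apply πref hdensity]
    simp only [sub_div, Real.exp_sub, exp_vLSE_div hq hτ]
    rfl
  have := isProbabilityMeasure_tilted (integrable_exp_div (πref := πref) hq hτ x)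
  rw [boltzmann, toPolicy_apply_of_measure_univ _ _ (by rw [htilted, measure_univ]), htilted]

theorem filteredPolicy_apply (hq : IsBddMeasurable q) {x : S}
    (hx : πref x (optActions πref q x) ≠ 0) :
    filteredPolicy πref q x = (πref x)[|optActions πref q x] := by
  have hopt : MeasurableSet {z : S × A | q z = essSup (fun a => q (z.1, a)) (πref z.1)} :=
    measurableSet_eq_fun hq.measurable ((measurable_essSup hq).comp measurable_fst)
  have hdensity : Measurable (Function.uncurry fun x a =>
      (πref x (optActions πref q x))⁻¹ *
        (optActions πref q x).indicator (fun _ => (1 : ℝ≥0∞)) a) :=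
    ((Kernel.measurable_kernel_prodMk_left hopt).comp measurable_fst).inv.mul
      (measurable_const.indicator hopt)
  have hcond : πref.withDensity (fun x a => (πref x (optActions πref q x))⁻¹ *
      (optActions πref q x).indicator (fun _ => 1) a) x = (πref x)[|optActions πref q x] := by
    rw [Kernel.withDensity_apply πref hdensity, ProbabilityTheory.cond,
      ← withDensity_indicator_one (measurableSet_optActions hq.measurable x),
      ← withDensity_smul _ (measurable_one.indicator (measurableSet_optActions hq.measurable x))]
    rfl
  have := cond_isProbabilityMeasure hx
  rw [filteredPolicy, toPolicy_apply_of_measure_univ _ _ (by rw [hcond, measure_univ]), hcond]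

/-- The error `ρ τ * τ` of the potential is divided by the temperature `τ` in the exponent, where it
therefore disappears. -/
theorem tvTendsto_boltzmann (hq : IsBddMeasurable q) {qs : ℝ → S × A → ℝ}
    (hqs : ∀ τ, 0 < τ → IsBddMeasurable (qs τ)) {ρ : ℝ → ℝ} (hρ : Tendsto ρ (𝓝[>] 0) (𝓝 0))
    (hdist : ∀ τ, 0 < τ → ∀ z, |qs τ z - q z| ≤ ρ τ * τ) {x : S}
    (hx : πref x (optActions πref q x) ≠ 0) :
    TVTendsto (𝓝[>] 0) (fun τ => boltzmann πref τ (qs τ) x) (filteredPolicy πref q x) := by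
  set e := essSup (fun a => q (x, a)) (πref x)
  have hpos : ∀ᶠ τ in 𝓝[>] (0 : ℝ), 0 < τ := eventually_mem_nhdsWithin
  have hdiff {τ : ℝ} (hτ : 0 < τ) (a : A) : |(qs τ (x, a) - q (x, a)) / τ| ≤ ρ τ := by
    rw [abs_div, abs_of_pos hτ, div_le_iff₀ hτ]
    exact hdist τ hτ _
  have hdiff_lim (a : A) : Tendsto (fun τ => (qs τ (x, a) - q (x, a)) / τ) (𝓝[>] 0) (𝓝 0) :=
    squeeze_zero_norm' (hpos.mono fun τ hτ => hdiff hτ a) hρ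
  have hsplit (τ : ℝ) (a : A) :
      qs τ (x, a) / τ - e / τ = (qs τ (x, a) - q (x, a)) / τ + (q (x, a) - e) / τ := by
    ring
  have hle : ∀ᵐ a ∂πref x, q (x, a) ≤ e := (hq.comp_prodMk_left x).ae_le_essSup
  rw [filteredPolicy_apply hq hx]
  refine (tvTendsto_tilted_cond (fs := fun τ a => qs τ (x, a) / τ - e / τ) (K := 1)
    (measurableSet_optActions hq.measurable x) hx ?_ ?_ ?_ ?_).congr' ?_
  · filter_upwards [hpos] with τ hτ
    exact (((hqs τ hτ).comp_prodMk_left x).measurable.div_const τ).sub_const _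
  · filter_upwards [hpos, hρ.eventually_le_const one_pos] with τ hτ hρ1
    filter_upwards [hle] with a ha
    have hnonpos := div_nonpos_of_nonpos_of_nonneg (sub_nonpos.2 ha) hτ.le
    linarith [hsplit τ a, (le_abs_self _).trans (hdiff hτ a)]
  · refine ae_of_all _ fun a (ha : q (x, a) = e) => ?_
    simpa only [hsplit, ha, sub_self, zero_div, add_zero] using hdiff_lim a
  · filter_upwards [hle] with a ha hmem
    simp only [hsplit]
    exact (hdiff_lim a).add_atBot (tendsto_inv_nhdsGT_zero.const_mul_atTop_of_neg
      (sub_neg.2 (lt_of_le_of_ne ha hmem)))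
  · filter_upwards [hpos] with τ hτ
    rw [boltzmann_apply (hqs τ hτ) hτ, tilted_sub_const]

theorem tvTendsto_decoupledPolicy (M : MDP S A) (hcov : M.Coverage πref) {σ : ℝ → ℝ}
    (hσpos : ∀ τ, 0 < τ → 0 < σ τ) (hσ : Tendsto (fun τ => σ τ / τ) (𝓝[>] 0) (𝓝 0)) (x : S) :
    TVTendsto (𝓝[>] 0) (fun τ => M.decoupledPolicy πref τ (σ τ) x)
      (filteredPolicy πref (M.qRef πref) x) := by
  obtain ⟨K, hK⟩ := M.exists_abs_qSoft_sub_qRef_le hcov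
  have hKσ : Tendsto (fun τ => K * (σ τ / τ)) (𝓝[>] 0) (𝓝 0) := by
    simpa only [mul_zero] using hσ.const_mul K
  refine tvTendsto_boltzmann (M.isBddMeasurable_qRef πref)
    (fun τ hτ => M.isBddMeasurable_qSoft πref (hσpos τ hτ)) hKσ (fun τ hτ z => ?_)
    (measure_optActions_qRef_ne_zero M hcov x)
  rw [mul_assoc, div_mul_cancel₀ _ hτ.ne']
  exact hK _ (hσpos τ hτ) z

end Policies

end MDP

theorem mainTheorem2_general {S A : Type*} [MeasurableSpace S] [MeasurableSpace A]
    (M : MDP S A) (πref : Kernel S A) [IsMarkovKernel πref] (hcov : M.Coverage πref)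
    {σ : ℝ → ℝ} (hσpos : ∀ τ, 0 < τ → 0 < σ τ)
    (hσ : Tendsto (fun τ => σ τ / τ) (𝓝[>] 0) (𝓝 0))
    {p p' : ℝ} (hp : 0 < p) (hp' : 0 < p') (ω : Measure (S × A)) [IsFiniteMeasure ω] :
    Tendsto (fun τ => integratedWasserstein p p' ω
        (M.returnDist (M.decoupledPolicy πref τ (σ τ)))
        (M.returnDist (MDP.filteredPolicy πref (M.qRef πref))))
      (𝓝[>] 0) (𝓝 0) :=
  M.tendsto_integratedWasserstein_returnDist
    (fun x => MDP.tvTendsto_decoupledPolicy M hcov hσpos hσ x) hp hp' ω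

theorem mainTheorem2 {S A : Type*} [MeasurableSpace S] [MeasurableSpace A]
    [Countable A] [DiscreteMeasurableSpace A]
    (M : MDP S A) (πref : Kernel S A) [IsMarkovKernel πref]
    (hcov : M.Coverage πref)
    (σ : ℝ → ℝ) (hσpos : ∀ τ, 0 < τ → 0 < σ τ)
    (hσ : Tendsto (fun τ => σ τ / τ) (𝓝[>] 0) (𝓝 0))
    (p p' : ℝ) (hp : 1 ≤ p) (hp' : 1 ≤ p')
    (ω : Measure (S × A)) [IsProbabilityMeasure ω] :
    Tendsto (fun τ => integratedWasserstein p p' ω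
        (M.returnDist (M.decoupledPolicy πref τ (σ τ)))
        (M.returnDist (MDP.filteredPolicy πref (M.qRef πref))))
      (𝓝[>] 0) (𝓝 0) ∧
    (M.qStar = M.qRef πref →
      Tendsto (fun τ => integratedWasserstein p p' ω
          (M.returnDist (M.decoupledPolicy πref τ (σ τ)))
          (M.returnDist (MDP.filteredPolicy πref M.qStar)))
        (𝓝[>] 0) (𝓝 0)) := by
  have hconv := mainTheorem2_general M πref hcov hσpos hσ
    (one_pos.trans_le hp) (one_pos.trans_le hp') ω
  exact ⟨hconv, fun hq => by simpa only [hq] using hconv⟩
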